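/- All graphs are finite, simple and undirected. For graphs $G,H$ with $|V(G)|=|V(H)|$, let $\delta_{\mathsf{edit}}(G,H)$ be the minimum, over all bijections $\pi\colon V(G)\to V(H)$, of $|E(G)^\pi\mathbin{\triangle}E(H)|$, where $E(G)^\pi=\{\{\pi(v),\pi(w)\} : \{v,w\}\in E(G)\}$. The VC dimension of $G$ is the VC dimension of the set system $\{N_G(v) : v\in V(G)\}$ of all neighbourhoods, i.e. the maximal size of a set $X\subseteq V(G)$ with $\{N_G(v)\cap X : v\in V(G)\}=2^X$. For $k\ge 1$, the $k$-dimensional Weisfeiler–Leman algorithm ($k$-WL) computes colourings $\chi^i_G$ of $V(G)^k$ for $i=0,1,2,\dots$. The colour $\chi^0_G(\bar v)$ records, for all $a,b\in[k]$, whether $v_a=v_b$ and whether $v_av_b\in E(G)$. Further, $\chi^{i+1}_G(\bar v)=(\chi^i_G(\bar v),\mathcal M)$, where $\mathcal M$ is the multiset of the tuples $(\chi^i_G(\bar v[w/1]),\dots,\chi^i_G(\bar v[w/k]))$ over all $w\in V(G)$ if $k\ge2$, and over all $w\in N_G(v_1)$ if $k=1$; here $\bar v[w/a]$ is obtained from $\bar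 v$ by replacing the $a$-th entry by $w$. Run $k$-WL on $G$ and $H$ in parallel, and let $i_\infty$ be the first round $i$ in which the joint colouring of the disjoint union of $V(G)^k$ and $V(H)^k$ is stable, i.e. induces the same partition as in round $i+1$. Then $k$-WL distinguishes $G$ and $H$ if some colour $c$ satisfies $|\{\bar v\in V(G)^k : \chi^{i_\infty}_G(\bar v)=c\}|\neq|\{\bar w\in V(H)^k : \chi^{i_\infty}_H(\bar w)=c\}|$. **Theorem.** The $O\left(\frac d\epsilon\log\frac1\epsilon\right)$-dimensional Weisfeiler–Leman algorithm distinguishes all pairs of non-isomorphic $n$-vertex graphs $G,H$ such that $G$ has VC dimension at most $d$ and $\delta_{\mathsf{edit}}(G,H)\ge\epsilon n^2$. That is, there is an absolute constant $C>0$ such that for all integers $d\ge0$, all real $\epsilon>0$, and all integers $k\ge1$ with $k\ge C\cdot\frac d\epsilon\log\frac1\epsilon$, $k$-WL distinguishes every pair of non-isomorphic $n$-vertex graphs $G,H$, for every $n$, such that $G$ has VC dimension at most $d$ and $\delta_{\mathsf{edit}}(G,H)\ge\epsilon n^2$. -/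

import Mathlib

open scoped symmDiff

noncomputable section

namespace RobustGI

/-! ### Graph edit distance -/

/-- The edit cost of a bijection `π` between the vertex sets of `G` and `H`: the cardinality of
`E(G)^π ∆ E(H)`. -/
def editCost {V W : Type*} (G : SimpleGraph V) (H : SimpleGraph W) (π : V ≃ W) : ℕ :=
  ((Sym2.map π '' G.edgeSet) ∆ H.edgeSet).ncard

/-- The graph edit distance: the minimum edit cost over all bijections `V(G) → V(H)`
(it is used only for graphs of the same order, so that there is such a bijection). -/
def editDist {V W : Type*} (G : SimpleGraph V) (H : SimpleGraph W) : ℕ :=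
  ⨅ π : V ≃ W, editCost G H π

/-! ### VC dimension of a graph -/

open Classical in
/-- The neighbourhood set system `{N_G(v) | v ∈ V(G)}`. -/
def nbhdSystem {V : Type*} [Fintype V] (G : SimpleGraph V) : Finset (Finset V) :=
  Finset.univ.image fun v => G.neighborFinset v

open Classical in
/-- The VC dimension of a graph is the VC dimension of its neighbourhood set system. -/
def graphVCDim {V : Type*} [Fintype V] (G : SimpleGraph V) : ℕ :=
  (nbhdSystem G).vcDim

/-! ### The `k`-dimensional Weisfeiler-Leman algorithm -/

/-- The colours used in round `i` of `k`-WL; they do not depend on the graph, so that colours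
of tuples of two different graphs can be compared. A colour of round `0` records for all
positions `a, b` of a tuple whether the two entries are equal and whether they are adjacent.
A colour of round `i + 1` is a colour of round `i` with a multiset of `k`-tuples of colours of
round `i`. -/
def WLColor (k : ℕ) : ℕ → Type
  | 0 => Fin k → Fin k → Prop × Prop
  | i + 1 => WLColor k i × Multiset (Fin k → WLColor k i)

open Classical in
/-- The colouring of `V(G)^k` computed by `k`-WL in round `i`. In each round the colour of `v` is
refined by the multiset of the tuples `(χ (v[w/1]), …, χ (v[w/k]))`, where `χ` is the previous
colouring, and where `w` ranges over all vertices if `k ≥ 2`, and over the neighbours of the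
only entry of `v` if `k = 1`. -/
def wlColoring {V : Type*} [Fintype V] (G : SimpleGraph V) (k : ℕ) :
    (i : ℕ) → (Fin k → V) → WLColor k i
  | 0 => fun v a b => (v a = v b, G.Adj (v a) (v b))
  | i + 1 => fun v =>
      (wlColoring G k i v,
        (Finset.univ.filter fun w : V => k = 1 → ∀ a, G.Adj (v a) w).val.map
          fun w a => wlColoring G k i (Function.update v a w))

/-- The colouring `f` refines the colouring `g`. -/
def Refines {X C D : Type*} (f : X → C) (g : X → D) : Prop :=
  ∀ x y, f x = f y → g x = g y

/-- The colourings `f` and `g` are equivalent: they refine each other. -/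
def EquivColorings {X C D : Type*} (f : X → C) (g : X → D) : Prop :=
  Refines f g ∧ Refines g f

/-- The colouring of the disjoint union of `V(G)^k` and `V(H)^k` in round `i`, when `k`-WL is run
on `G` and `H` in parallel. -/
def wlJoint {V W : Type*} [Fintype V] [Fintype W] (G : SimpleGraph V) (H : SimpleGraph W)
    (k i : ℕ) : (Fin k → V) ⊕ (Fin k → W) → WLColor k i :=
  Sum.elim (wlColoring G k i) (wlColoring H k i)

/-- The first round in which the joint colouring is stable, that is, not properly refined by
the next one. -/
def wlStableRound {V W : Type*} [Fintype V] [Fintype W] (G : SimpleGraph V)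
    (H : SimpleGraph W) (k : ℕ) : ℕ :=
  sInf {i | EquivColorings (wlJoint G H k i) (wlJoint G H k (i + 1))}

/-- `k`-WL distinguishes `G` and `H`: in the stable colouring there is a colour that occurs on
different numbers of `k`-tuples of `G` and of `H`. -/
def WLDistinguishes {V W : Type*} [Fintype V] [Fintype W] (k : ℕ) (G : SimpleGraph V)
    (H : SimpleGraph W) : Prop :=
  ∃ c : WLColor k (wlStableRound G H k),
    {v : Fin k → V | wlColoring G k (wlStableRound G H k) v = c}.ncard ≠
      {w : Fin k → W | wlColoring H k (wlStableRound G H k) w = c}.ncard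

end RobustGI

end

/-! Suppose `k`-WL fails to distinguish `G` and `H`. Put a set `S` of fewer than `k` vertices into
all slots of a tuple but one. Stability matches this tuple with one of `H`, and varying the free
slot gives equitable partitions of both graphs with equal parameters, refining the partition of `G`
by traces on `S` (`exists_editCost_le_spread`). A uniformly random colour-preserving bijection then
has at most half the `spread` of that partition as expected edit cost (`exists_equiv_editCost_le`).

It remains to find a small `S` of spread at most `εn²`, contradicting edit distance at least `εn²`.
This is an entropy increment: if the spread is larger, some vertex added to `S` raises the entropy
of the trace partition by at least `εn` (`cellEntropy_insert`), while Sauer–Shelah bounds the number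
of traces, hence the entropy (`exists_nbhdTrace_spread_le`). -/

namespace RobustGI

/-! ### Cell averages and spread -/

section Spread

open Classical Finset

variable {V W ι κ : Type*} [Fintype V] [Fintype W]

/-- The set of all vertices with the same colour as `u`. -/
noncomputable def cell (f : V → ι) (u : V) : Finset V := {t | f t = f u}

lemma mem_cell {f : V → ι} {t u : V} : t ∈ cell f u ↔ f t = f u := by simp [cell]

lemma cell_congr {f : V → ι} {t u : V} (h : f t = f u) : cell f t = cell f u := by
  simp [cell, h]

lemma card_cell_pos (f : V → ι) (u : V) : (0 : ℝ) < #(cell f u) := by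
  exact_mod_cast card_pos.2 ⟨u, mem_cell.2 rfl⟩

/-- The average of `g` over the cell of `u`. -/
noncomputable def cellMean (f : V → ι) (g : V → ℝ) (u : V) : ℝ :=
  (∑ t ∈ cell f u, g t) / #(cell f u)

lemma cellMean_congr {f : V → ι} (g : V → ℝ) {t u : V} (h : f t = f u) :
    cellMean f g t = cellMean f g u := by
  simp [cellMean, cell_congr h]

/-- Cell averaging is the orthogonal projection onto the functions constant on cells. -/
lemma sum_cellMean_mul (f : V → ι) (g h : V → ℝ) (hh : ∀ t u, f t = f u → h t = h u) :
    ∑ u, cellMean f g u * h u = ∑ u, g u * h u := by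
  have h1 : ∀ u, cellMean f g u * h u
      = ∑ t, if f t = f u then g t * h t / #(cell f t) else 0 := by
    intro u
    rw [cellMean, sum_div, sum_mul, ← sum_filter]
    refine sum_congr rfl fun t ht => ?_
    have ht' := mem_cell.1 ht
    rw [hh t u ht', cell_congr ht']
    ring
  simp_rw [h1]
  rw [sum_comm]
  refine sum_congr rfl fun t _ => ?_
  rw [← sum_filter, sum_const, nsmul_eq_mul]
  have h2 : (univ.filter fun u => f t = f u) = cell f t := by
    ext u; simp [cell, eq_comm]
  rw [h2, mul_div_cancel₀ _ (card_cell_pos f t).ne']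

lemma sum_cellMean (f : V → ι) (g : V → ℝ) : ∑ u, cellMean f g u = ∑ u, g u := by
  simpa using sum_cellMean_mul f g 1 (by simp)

/-- Each side is the squared norm of a projection of `g`; the difference is the squared norm of the
difference of the projections. -/
lemma sum_mul_cellMean_le_of_refines {f : V → ι} {f' : V → κ} (h : Refines f f') (g : V → ℝ) :
    ∑ u, g u * cellMean f' g u ≤ ∑ u, g u * cellMean f g u := by
  have h1 := sum_cellMean_mul f g (cellMean f g) fun t u h => cellMean_congr g h
  have h2 := sum_cellMean_mul f g (cellMean f' g) fun t u hf => cellMean_congr g (h t u hf)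
  have h3 := sum_cellMean_mul f' g (cellMean f' g) fun t u h => cellMean_congr g h
  have h4 : 0 ≤ ∑ u, (cellMean f g u - cellMean f' g u) ^ 2 := sum_nonneg fun _ _ => sq_nonneg _
  have h5 : ∑ u, (cellMean f g u - cellMean f' g u) ^ 2
      = ∑ u, cellMean f g u * cellMean f g u - 2 * ∑ u, cellMean f g u * cellMean f' g u
        + ∑ u, cellMean f' g u * cellMean f' g u := by
    rw [mul_sum, ← sum_sub_distrib, ← sum_add_distrib]
    exact sum_congr rfl fun _ _ => by ring
  linarith

/-- The indicator function of adjacency. -/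
noncomputable def adjInd (G : SimpleGraph V) (v u : V) : ℝ := if G.Adj v u then 1 else 0

omit [Fintype V] in
lemma sum_adjInd (G : SimpleGraph V) (v : V) (s : Finset V) :
    ∑ u ∈ s, adjInd G v u = #{u ∈ s | G.Adj v u} := by
  simp [adjInd]

/-- For each vertex `v`, the expected number of vertices `u` such that `v` distinguishes `u`
from a random vertex of the cell of `u`, summed over all `v`. -/
noncomputable def spread (G : SimpleGraph V) (f : V → ι) : ℝ :=
  ∑ v, ∑ u, (adjInd G v u + cellMean f (adjInd G v) u
    - 2 * (adjInd G v u * cellMean f (adjInd G v) u))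

lemma spread_eq (G : SimpleGraph V) (f : V → ι) :
    spread G f = ∑ v, (2 * ∑ u, adjInd G v u
      - 2 * ∑ u, adjInd G v u * cellMean f (adjInd G v) u) := by
  refine sum_congr rfl fun v _ => ?_
  rw [sum_sub_distrib, sum_add_distrib, sum_cellMean, ← mul_sum, two_mul (∑ u, adjInd G v u)]

lemma spread_le_of_refines {G : SimpleGraph V} {f : V → ι} {f' : V → κ} (h : Refines f f') :
    spread G f ≤ spread G f' := by
  rw [spread_eq, spread_eq]
  refine sum_le_sum fun v _ => ?_
  linarith [sum_mul_cellMean_le_of_refines h (adjInd G v)]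

/-! ### Edit cost of an average colour-preserving bijection -/

/-- The graph on `W` whose edges are the edits of `π`. -/
def editGraph (G : SimpleGraph V) (H : SimpleGraph W) (π : V ≃ W) : SimpleGraph W where
  Adj x y := ¬ (G.Adj (π.symm x) (π.symm y) ↔ H.Adj x y)
  symm := ⟨fun x y h => by rwa [G.adj_comm, H.adj_comm]⟩
  loopless := ⟨fun x h => by simp at h⟩

omit [Fintype V] [Fintype W] in
lemma editCost_eq_card_edgeSet (G : SimpleGraph V) (H : SimpleGraph W) (π : V ≃ W) :
    editCost G H π = (editGraph G H π).edgeSet.ncard := by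
  rw [editCost]
  congr 1
  ext e
  induction e with
  | _ x y =>
    have h : s(x, y) ∈ Sym2.map π '' G.edgeSet ↔ G.Adj (π.symm x) (π.symm y) := by
      constructor
      · rintro ⟨e, he, hxy⟩
        have := congrArg (Sym2.map π.symm) hxy
        rw [Sym2.map_map] at this
        simp at this
        rw [this] at he
        simpa using he
      · intro h
        exact ⟨s(π.symm x, π.symm y), h, by simp⟩
    rw [Set.mem_symmDiff, h]
    simp only [SimpleGraph.mem_edgeSet, editGraph]
    tauto

/-- For 0/1 values, `a + b - 2ab` indicates disagreement; each edit is counted as two ordered pairs.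
-/
lemma two_mul_editCost (G : SimpleGraph V) (H : SimpleGraph W) (π : V ≃ W) :
    2 * (editCost G H π : ℝ) = ∑ v, ∑ u, (adjInd G v u + adjInd H (π v) (π u)
      - 2 * (adjInd G v u * adjInd H (π v) (π u))) := by
  have h := (editGraph G H π).sum_degrees_eq_twice_card_edges
  rw [editCost_eq_card_edgeSet, Set.ncard_eq_toFinset_card', ← SimpleGraph.edgeFinset]
  have h' : (2 : ℝ) * #(editGraph G H π).edgeFinset
      = ∑ w, ((editGraph G H π).degree w : ℝ) := by exact_mod_cast h.symm
  rw [h', ← Equiv.sum_comp π]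
  refine sum_congr rfl fun v _ => ?_
  rw [← SimpleGraph.card_neighborFinset_eq_degree, SimpleGraph.neighborFinset_eq_filter,
    ← sum_boole, ← Equiv.sum_comp π]
  refine sum_congr rfl fun u _ => ?_
  by_cases h1 : G.Adj v u <;> by_cases h2 : H.Adj (π v) (π u) <;>
    norm_num [editGraph, adjInd, h1, h2]

lemma two_mul_editCost_le (G : SimpleGraph V) (H : SimpleGraph W) (π : V ≃ W) :
    2 * (editCost G H π : ℝ) ≤ (Fintype.card V : ℝ) ^ 2 := by
  rw [two_mul_editCost]
  calc _ ≤ ∑ v : V, ∑ u : V, (1 : ℝ) := by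
        refine sum_le_sum fun v _ => sum_le_sum fun u _ => ?_
        by_cases h1 : G.Adj v u <;> by_cases h2 : H.Adj (π v) (π u) <;>
          simp [adjInd, h1, h2]
    _ = _ := by simp [sq]

lemma cell_sum_adjInd {G : SimpleGraph V} {H : SimpleGraph W} {f : V → ι} {g : W → ι}
    (hdeg : ∀ v w c, f v = g w → #{u | f u = c ∧ G.Adj v u} = #{u | g u = c ∧ H.Adj w u})
    {σ : V ≃ W} (hσ : ∀ v, g (σ v) = f v) (v u : V) :
    ∑ t ∈ cell f u, adjInd H (σ v) (σ t) = ∑ t ∈ cell f u, adjInd G v t := by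
  rw [sum_adjInd]
  have h := hdeg v (σ v) (f u) (hσ v).symm
  rw [cell, filter_filter, h, ← filter_filter, ← sum_boole]
  refine sum_bij (fun t _ => σ t) ?_ ?_ ?_ ?_
  · intro t ht; simp only [mem_filter, mem_univ, true_and] at ht ⊢; rw [hσ, ht]
  · intro a _ b _ h; exact σ.injective h
  · intro w hw
    refine ⟨σ.symm w, ?_, by simp⟩
    simp only [mem_filter, mem_univ, true_and] at hw ⊢
    rw [← hσ, σ.apply_symm_apply, hw]
  · intro t _; rfl

theorem exists_equiv_editCost_le {G : SimpleGraph V} {H : SimpleGraph W} {f : V → ι} {g : W → ι}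
    (hcard : ∀ c, #{v | f v = c} = #{w | g w = c})
    (hdeg : ∀ v w c, f v = g w → #{u | f u = c ∧ G.Adj v u} = #{u | g u = c ∧ H.Adj w u}) :
    ∃ π : V ≃ W, 2 * (editCost G H π : ℝ) ≤ spread G f := by
  let Γ := {σ : V ≃ W // ∀ v, g (σ v) = f v}
  have : Nonempty Γ := by
    have e : ∀ c, Nonempty ({v // f v = c} ≃ {w // g w = c}) := fun c =>
      ⟨Fintype.equivOfCardEq (by rw [Fintype.card_subtype, Fintype.card_subtype, hcard c])⟩
    exact ⟨⟨Equiv.ofFiberEquiv fun c => (e c).some, fun v => Equiv.ofFiberEquiv_map _ v⟩⟩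
  have key : ∀ v u, u ≠ v →
      Fintype.card Γ * cellMean f (adjInd G v) u ≤ ∑ σ : Γ, adjInd H (σ.1 v) (σ.1 u) := by
    intro v u huv
    rw [cellMean, ← mul_div_assoc, div_le_iff₀ (card_cell_pos f u)]
    have h1 : ∀ t ∈ cell f u, ∑ σ : Γ, adjInd H (σ.1 v) (σ.1 t)
        ≤ ∑ σ : Γ, adjInd H (σ.1 v) (σ.1 u) := by
      intro t ht
      -- Loops are absent, so `t = v` contributes 0. Any other `t` in the cell is exchanged with `u`
      -- by a swap fixing `v`, which permutes `Γ`.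
      by_cases htv : t = v
      · subst htv
        refine sum_le_sum fun σ _ => ?_
        have : adjInd H (σ.1 t) (σ.1 t) = 0 := by simp [adjInd]
        rw [this, adjInd]
        split_ifs <;> norm_num
      · have hs : ∀ x, f (Equiv.swap u t x) = f x := by
          intro x
          have := mem_cell.1 ht
          by_cases hxu : x = u
          · subst hxu; simpa using this
          · by_cases hxt : x = t
            · subst hxt; simpa using this.symm
            · rw [Equiv.swap_apply_of_ne_of_ne hxu hxt]
        let e : Γ → Γ := fun σ => ⟨(Equiv.swap u t).trans σ.1, fun x => by
          rw [Equiv.trans_apply, σ.2, hs]⟩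
        have he : Function.Involutive e := by
          intro σ
          apply Subtype.ext
          ext x
          simp [e]
        rw [← Equiv.sum_comp he.toPerm]
        refine le_of_eq (sum_congr rfl fun σ _ => ?_)
        simp [e, Equiv.swap_apply_of_ne_of_ne huv.symm (Ne.symm htv)]
    calc (Fintype.card Γ : ℝ) * ∑ t ∈ cell f u, adjInd G v t
        = ∑ σ : Γ, ∑ t ∈ cell f u, adjInd H (σ.1 v) (σ.1 t) := by
          rw [sum_congr rfl fun σ _ => cell_sum_adjInd hdeg σ.2 v u]
          simp
      _ = ∑ t ∈ cell f u, ∑ σ : Γ, adjInd H (σ.1 v) (σ.1 t) := sum_comm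
      _ ≤ ∑ t ∈ cell f u, ∑ σ : Γ, adjInd H (σ.1 v) (σ.1 u) := sum_le_sum h1
      _ = _ := by rw [sum_const, nsmul_eq_mul, mul_comm]
  have hrow : ∀ (σ : Γ) v, ∑ u, adjInd H (σ.1 v) (σ.1 u) = ∑ u, adjInd G v u := by
    intro σ v
    rw [← sum_cellMean f, ← sum_cellMean f (adjInd G v)]
    refine sum_congr rfl fun u _ => ?_
    rw [cellMean, cellMean, cell_sum_adjInd hdeg σ.2 v u]
  have htotal : ∑ σ : Γ, 2 * (editCost G H σ.1 : ℝ) ≤ ∑ _σ : Γ, spread G f := by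
    have h1 : ∀ σ : Γ, 2 * (editCost G H σ.1 : ℝ) = ∑ v, (2 * ∑ u, adjInd G v u
        - 2 * ∑ u, adjInd G v u * adjInd H (σ.1 v) (σ.1 u)) := by
      intro σ
      rw [two_mul_editCost]
      refine sum_congr rfl fun v _ => ?_
      rw [sum_sub_distrib, sum_add_distrib, hrow, ← mul_sum, two_mul (∑ u, adjInd G v u)]
    simp_rw [h1]
    rw [sum_comm, sum_const, spread_eq, smul_sum]
    refine sum_le_sum fun v _ => ?_
    rw [sum_sub_distrib, sum_const, nsmul_eq_mul, nsmul_eq_mul, mul_sub, ← mul_sum]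
    have h2 : (Fintype.card Γ : ℝ) * ∑ u, adjInd G v u * cellMean f (adjInd G v) u
        ≤ ∑ σ : Γ, ∑ u, adjInd G v u * adjInd H (σ.1 v) (σ.1 u) := by
      rw [sum_comm, mul_sum]
      refine sum_le_sum fun u _ => ?_
      rw [← mul_sum]
      by_cases huv : u = v
      · simp [adjInd, huv]
      · have := mul_le_mul_of_nonneg_left (key v u huv)
          (show 0 ≤ adjInd G v u by rw [adjInd]; split_ifs <;> norm_num)
        linarith
    rw [card_univ]
    linarith
  obtain ⟨σ, -, hσ⟩ := exists_le_of_sum_le univ_nonempty htotal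
  exact ⟨σ.1, hσ⟩

end Spread

end RobustGI

namespace RobustGI

/-! ### Traces, Sauer–Shelah and entropy increment -/

section Trace

open Classical Finset

variable {V : Type*} [Fintype V]

/-- The trace of the neighbourhood of `v` on `S`. -/
noncomputable def nbhdTrace (G : SimpleGraph V) (S : Finset V) (v : V) : Finset V :=
  {x ∈ S | G.Adj v x}

omit [Fintype V] in
lemma nbhdTrace_eq_iff {G : SimpleGraph V} {S : Finset V} {v u : V} :
    nbhdTrace G S v = nbhdTrace G S u ↔ ∀ x ∈ S, G.Adj v x ↔ G.Adj u x := by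
  rw [nbhdTrace, nbhdTrace, filter_inj']

/-- A family has at most as many members as it shatters sets, and a set shattered by the traces lies
in `S` and is shattered by the neighbourhoods. -/
lemma card_image_nbhdTrace_le (G : SimpleGraph V) (S : Finset V) {d : ℕ}
    (hd : graphVCDim G ≤ d) :
    #(univ.image (nbhdTrace G S)) ≤ ∑ i ∈ range (d + 1), (#S).choose i := by
  refine (card_le_card_shatterer _).trans ?_
  have hsub : (univ.image (nbhdTrace G S)).shatterer
      ⊆ (range (d + 1)).biUnion fun i => powersetCard i S := by
    intro T hT
    rw [mem_shatterer] at hT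
    have hTS : T ⊆ S := by
      obtain ⟨u, hu, hTu⟩ := hT.exists_superset
      obtain ⟨v, -, rfl⟩ := mem_image.1 hu
      exact hTu.trans (filter_subset _ _)
    have hsh : (nbhdSystem G).Shatters T := by
      intro t ht
      obtain ⟨u, hu, hTu⟩ := hT ht
      obtain ⟨v, -, rfl⟩ := mem_image.1 hu
      refine ⟨G.neighborFinset v, mem_image_of_mem _ (mem_univ v), ?_⟩
      rw [← hTu]
      ext x
      simp only [nbhdTrace, mem_inter, mem_filter, SimpleGraph.mem_neighborFinset]
      exact ⟨fun h => ⟨h.1, hTS h.1, h.2⟩, fun h => ⟨h.1, h.2.2⟩⟩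
    have hcard : #T ≤ d := hsh.card_le_vcDim.trans hd
    exact mem_biUnion.2 ⟨#T, mem_range.2 (by omega), mem_powersetCard.2 ⟨hTS, rfl⟩⟩
  refine (card_le_card hsub).trans (card_biUnion_le.trans ?_)
  simp [card_powersetCard]

lemma log_sum_choose_le (s d : ℕ) {x : ℝ} (hx : 0 < x) (hx1 : x ≤ 1) :
    Real.log (∑ i ∈ range (d + 1), (s.choose i : ℝ)) ≤ x * s + d * Real.log (1 / x) := by
  set N := ∑ i ∈ range (d + 1), (s.choose i : ℝ) with hN
  have hpos : 0 < N := by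
    refine sum_pos' (fun i _ => by positivity) ⟨0, by simp, by simp⟩
  have h1 : x ^ d * N ≤ (x + 1) ^ s := by
    calc x ^ d * N ≤ ∑ i ∈ range (d + 1), x ^ i * s.choose i := by
          rw [hN, mul_sum]
          refine sum_le_sum fun i hi => ?_
          have : x ^ d ≤ x ^ i := pow_le_pow_of_le_one hx.le hx1 (by simp at hi; omega)
          gcongr
      _ ≤ ∑ i ∈ range (s + 1 + d), x ^ i * s.choose i := by
          refine sum_le_sum_of_subset_of_nonneg ?_ fun i _ _ => by positivity
          intro i hi; simp at hi ⊢; omega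
      _ = ∑ i ∈ range (s + 1), x ^ i * s.choose i := by
          symm
          refine sum_subset (fun i hi => by simp at hi ⊢; omega) fun i _ hi => ?_
          rw [Nat.choose_eq_zero_of_lt (by simp at hi; omega)]
          simp
      _ = (x + 1) ^ s := by rw [add_pow]; simp
  have h2 : (x + 1) ^ s ≤ Real.exp (x * s) := by
    rw [mul_comm, Real.exp_nat_mul]
    gcongr
    exact Real.add_one_le_exp x
  have h3 := Real.log_le_log (by positivity) (h1.trans h2)
  rw [Real.log_exp, Real.log_mul (by positivity) hpos.ne', Real.log_pow] at h3
  rw [one_div, Real.log_inv]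
  linarith

/-! ### The entropy of a partition into cells -/

/-- The (unnormalised) entropy of the partition of `V` into cells. -/
noncomputable def cellEntropy {ι : Type*} (f : V → ι) : ℝ :=
  ∑ v, Real.log (Fintype.card V / #(cell f v))

lemma cellEntropy_nonneg {ι : Type*} (f : V → ι) : 0 ≤ cellEntropy f := by
  refine sum_nonneg fun v _ => Real.log_nonneg ?_
  rw [one_le_div (card_cell_pos f v)]
  exact_mod_cast card_le_univ _

lemma sum_inv_card_cell {ι : Type*} [DecidableEq ι] (f : V → ι) :
    ∑ v, (1 : ℝ) / #(cell f v) = #(univ.image f) := by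
  rw [← sum_fiberwise_of_maps_to (g := f) (t := univ.image f)
    fun v _ => mem_image_of_mem f (mem_univ v),
    card_eq_sum_ones, Nat.cast_sum]
  refine sum_congr rfl fun c hc => ?_
  obtain ⟨u, -, rfl⟩ := mem_image.1 hc
  have h : ∀ v ∈ univ.filter (fun v => f v = f u), (1 : ℝ) / #(cell f v) = 1 / #(cell f u) := by
    intro v hv
    rw [cell_congr (mem_filter.1 hv).2]
  rw [sum_congr rfl h, sum_const, nsmul_eq_mul]
  have h' : (univ.filter fun v => f v = f u) = cell f u := by ext; simp [cell]
  rw [h', mul_one_div_cancel (card_cell_pos f u).ne', Nat.cast_one]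

/-- Jensen's inequality in the form `log t ≤ t - 1`, tight for cells of equal size. -/
lemma cellEntropy_le {ι : Type*} [DecidableEq ι] (f : V → ι) :
    cellEntropy f ≤ Fintype.card V * Real.log #(univ.image f) := by
  rcases isEmpty_or_nonempty V with hV | hV
  · simp [cellEntropy]
  have hn : (0 : ℝ) < Fintype.card V := by exact_mod_cast Fintype.card_pos
  have hm : (0 : ℝ) < #(univ.image f) := by
    exact_mod_cast card_pos.2 (univ_nonempty.image f)
  calc cellEntropy f ≤ ∑ v, (Fintype.card V / #(univ.image f) * (1 / #(cell f v)) - 1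
        + Real.log #(univ.image f)) := by
        refine sum_le_sum fun v _ => ?_
        have hc := card_cell_pos f v
        have h := Real.log_le_sub_one_of_pos
          (show (0 : ℝ) < (Fintype.card V / #(cell f v)) / #(univ.image f) by positivity)
        rw [Real.log_div (by positivity) hm.ne'] at h
        have h2 : ((Fintype.card V : ℝ) / #(cell f v)) / #(univ.image f)
          = Fintype.card V / #(univ.image f) * (1 / #(cell f v)) := by field_simp
        linarith
    _ = _ := by
        rw [sum_add_distrib, sum_sub_distrib, ← mul_sum, sum_inv_card_cell]
        simp only [sum_const, card_univ, nsmul_eq_mul, mul_one]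
        field_simp
        ring

/-- The summand at `u` is the fraction of the cell of `u` that `x` splits off, `1 - new/old`, and
this is at most `log (old/new)`. -/
lemma cellEntropy_insert (G : SimpleGraph V) (S : Finset V) (x : V) :
    cellEntropy (nbhdTrace G S) + ∑ u, (adjInd G x u + cellMean (nbhdTrace G S) (adjInd G x) u
      - 2 * (adjInd G x u * cellMean (nbhdTrace G S) (adjInd G x) u))
      ≤ cellEntropy (nbhdTrace G (insert x S)) := by
  rcases isEmpty_or_nonempty V with hV | hV
  · simp [cellEntropy]
  have hn : (0 : ℝ) < Fintype.card V := by exact_mod_cast Fintype.card_pos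
  rw [cellEntropy, cellEntropy, ← sum_add_distrib]
  refine sum_le_sum fun u _ => ?_
  have hc := card_cell_pos (nbhdTrace G S) u
  have hc' := card_cell_pos (nbhdTrace G (insert x S)) u
  have hcell : cell (nbhdTrace G (insert x S)) u
      = {t ∈ cell (nbhdTrace G S) u | G.Adj x t ↔ G.Adj x u} := by
    ext t
    simp only [mem_cell, mem_filter, nbhdTrace_eq_iff, mem_insert, forall_eq_or_imp]
    rw [G.adj_comm t x, G.adj_comm u x, and_comm]
  have hr : adjInd G x u + cellMean (nbhdTrace G S) (adjInd G x) u
      - 2 * (adjInd G x u * cellMean (nbhdTrace G S) (adjInd G x) u)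
      = 1 - (#(cell (nbhdTrace G (insert x S)) u) : ℝ) / #(cell (nbhdTrace G S) u) := by
    rw [cellMean, sum_adjInd, hcell]
    by_cases h : G.Adj x u
    · simp only [adjInd, h, if_true, iff_true]; ring
    · simp only [adjInd, h, if_false, iff_false]
      have := card_filter_add_card_filter_not (s := cell (nbhdTrace G S) u) (fun t => G.Adj x t)
      have h' : (#{t ∈ cell (nbhdTrace G S) u | G.Adj x t} : ℝ)
        + #{t ∈ cell (nbhdTrace G S) u | ¬ G.Adj x t} = #(cell (nbhdTrace G S) u) := by
        exact_mod_cast this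
      field_simp
      linarith
  rw [hr, Real.log_div hn.ne' hc.ne', Real.log_div hn.ne' hc'.ne']
  have h := Real.log_le_sub_one_of_pos (div_pos hc' hc)
  rw [Real.log_div hc'.ne' hc.ne'] at h
  linarith

lemma exists_nbhdTrace_spread_le (G : SimpleGraph V) {d s : ℕ} (hd : graphVCDim G ≤ d)
    {ε : ℝ} (hε : 0 < ε) (hε1 : ε ≤ 1) (hs : 2 * (d / ε * Real.log (2 / ε)) < s) :
    ∃ S : Finset V, #S ≤ s ∧ spread G (nbhdTrace G S) ≤ ε * (Fintype.card V : ℝ) ^ 2 := by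
  rcases isEmpty_or_nonempty V with hV | hV
  · exact ⟨∅, by simp, by simp [spread]⟩
  by_contra! hcon
  have hn : (0 : ℝ) < Fintype.card V := by exact_mod_cast Fintype.card_pos
  have hstep : ∀ j ≤ s, ∃ S : Finset V, #S ≤ j ∧
      j * (ε * Fintype.card V) ≤ cellEntropy (nbhdTrace G S) := by
    intro j
    induction j with
    | zero => exact fun _ => ⟨∅, by simp, by simpa using cellEntropy_nonneg _⟩
    | succ j ih =>
      intro hj
      obtain ⟨S, hS, hent⟩ := ih (by omega)
      have h1 : ∑ _x : V, ε * Fintype.card V ≤ spread G (nbhdTrace G S) := by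
        refine le_trans (le_of_eq ?_) (hcon S (by omega)).le
        rw [sum_const, card_univ, nsmul_eq_mul]
        ring
      obtain ⟨x, -, hx⟩ := exists_le_of_sum_le univ_nonempty h1
      refine ⟨insert x S, (card_insert_le _ _).trans (by omega), ?_⟩
      have := cellEntropy_insert G S x
      push_cast
      linarith
  obtain ⟨S, hS, hent⟩ := hstep s le_rfl
  have h1 := hent.trans (cellEntropy_le _)
  have h2 : (s : ℝ) * ε ≤ Real.log #(univ.image (nbhdTrace G S)) := by
    rw [← mul_assoc, mul_comm] at h1
    exact le_of_mul_le_mul_left h1 hn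
  have h3 : (#(univ.image (nbhdTrace G S)) : ℝ) ≤ ∑ i ∈ range (d + 1), (s.choose i : ℝ) := by
    have := (card_image_nbhdTrace_le G S hd).trans
      (sum_le_sum fun i _ => Nat.choose_le_choose i hS)
    exact_mod_cast this
  have h4 := Real.log_le_log
    (by exact_mod_cast card_pos.2 (univ_nonempty.image _)) h3
  -- With `x = ε / 2`, the linear term absorbs only half of `s * ε`.
  have h5 := log_sum_choose_le s d (half_pos hε) (by linarith)
  rw [one_div_div] at h5
  have h6 : (s : ℝ) * ε ≤ 2 * (d * Real.log (2 / ε)) := by linarith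
  have h7 : 2 * (d / ε * Real.log (2 / ε)) * ε = 2 * (d * Real.log (2 / ε)) := by
    field_simp
  have h8 := mul_lt_mul_of_pos_right hs hε
  linarith

lemma eq_bot_of_graphVCDim_eq_zero {G : SimpleGraph V} (h : graphVCDim G = 0) : G = ⊥ := by
  ext u v
  simp only [SimpleGraph.bot_adj, iff_false]
  intro huv
  have hsh : (nbhdSystem G).Shatters {v} := by
    intro t ht
    rcases subset_singleton_iff.1 ht with rfl | rfl
    · exact ⟨G.neighborFinset v, mem_image_of_mem _ (mem_univ v), by simp⟩
    · exact ⟨G.neighborFinset u, mem_image_of_mem _ (mem_univ u), by simp [huv]⟩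
  have := hsh.card_le_vcDim
  rw [graphVCDim] at h
  simp at this
  omega

end Trace

end RobustGI

namespace RobustGI

/-! ### Stable colourings of indistinguishable graphs -/

section WeisfeilerLeman

open Classical Finset

variable {V W : Type*} [Fintype V] [Fintype W] {G : SimpleGraph V} {H : SimpleGraph W} {k : ℕ}

lemma wlColoring_eq_of_succ {i : ℕ} {x : Fin k → V} {y : Fin k → W}
    (h : wlColoring G k (i + 1) x = wlColoring H k (i + 1) y) :
    wlColoring G k i x = wlColoring H k i y :=
  congrArg Prod.fst h

lemma atomic_of_wlColoring_eq {i : ℕ} {x : Fin k → V} {y : Fin k → W}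
    (h : wlColoring G k i x = wlColoring H k i y) (a b : Fin k) :
    G.Adj (x a) (x b) ↔ H.Adj (y a) (y b) := by
  induction i with
  | zero => exact iff_of_eq (congrArg Prod.snd (congrFun (congrFun h a) b))
  | succ i ih => exact ih (wlColoring_eq_of_succ h)

lemma refines_wlJoint_succ (i : ℕ) : Refines (wlJoint G H k (i + 1)) (wlJoint G H k i) := by
  rintro (x | x) (y | y) h <;> exact congrArg Prod.fst h

lemma exists_equivColorings_wlJoint (G : SimpleGraph V) (H : SimpleGraph W) (k : ℕ) :
    ∃ i, EquivColorings (wlJoint G H k i) (wlJoint G H k (i + 1)) := by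
  let X := (Fin k → V) ⊕ (Fin k → W)
  let P : ℕ →o (Set (X × X))ᵒᵈ :=
    ⟨fun i => OrderDual.toDual {p | wlJoint G H k i p.1 = wlJoint G H k i p.2},
      monotone_nat_of_le_succ fun i p hp => refines_wlJoint_succ i _ _ hp⟩
  obtain ⟨i, hi⟩ := WellFoundedGT.monotone_chain_condition P
  refine ⟨i, fun x y h => ?_, refines_wlJoint_succ i⟩
  have h1 : (x, y) ∈ OrderDual.ofDual (P i) := h
  rw [hi (i + 1) (Nat.le_succ i)] at h1
  exact h1

lemma refines_wlStableRound (G : SimpleGraph V) (H : SimpleGraph W) (k : ℕ) :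
    Refines (wlJoint G H k (wlStableRound G H k)) (wlJoint G H k (wlStableRound G H k + 1)) :=
  (Nat.sInf_mem (exists_equivColorings_wlJoint G H k)).1

lemma wlColoring_succ_eq_of_stable {x : Fin k → V} {y : Fin k → W}
    (h : wlColoring G k (wlStableRound G H k) x = wlColoring H k (wlStableRound G H k) y) :
    wlColoring G k (wlStableRound G H k + 1) x = wlColoring H k (wlStableRound G H k + 1) y :=
  refines_wlStableRound G H k (Sum.inl x) (Sum.inr y) h

lemma card_filter_eq_of_wlColoring_succ_eq (hk : k ≠ 1) {i : ℕ} {x : Fin k → V} {y : Fin k → W}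
    (h : wlColoring G k (i + 1) x = wlColoring H k (i + 1) y)
    (P : (Fin k → WLColor k i) → Prop) :
    #{w | P fun a => wlColoring G k i (Function.update x a w)}
      = #{w | P fun a => wlColoring H k i (Function.update y a w)} := by
  have h1 := congrArg (Multiset.countP P) (congrArg Prod.snd h)
  simpa [wlColoring, hk, Multiset.countP_map, card_def] using h1

lemma degree_eq_of_wlColoring_succ_eq {i : ℕ} {x : Fin 1 → V} {y : Fin 1 → W}
    (h : wlColoring G 1 (i + 1) x = wlColoring H 1 (i + 1) y) :
    #{w | G.Adj (x 0) w} = #{w | H.Adj (y 0) w} := by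
  have h1 := congrArg Multiset.card (congrArg Prod.snd h)
  simpa [wlColoring, card_def] using h1

lemma exists_wlColoring_eq (h : ¬ WLDistinguishes k G H) (x : Fin k → V) :
    ∃ y : Fin k → W,
      wlColoring G k (wlStableRound G H k) x = wlColoring H k (wlStableRound G H k) y := by
  rw [WLDistinguishes] at h
  push Not at h
  have h1 := h (wlColoring G k (wlStableRound G H k) x)
  by_contra! hcon
  have h2 : {w | wlColoring H k (wlStableRound G H k) w
      = wlColoring G k (wlStableRound G H k) x} = ∅ := by
    ext y; simpa using (hcon y).symm
  rw [h2, Set.ncard_empty, Set.ncard_eq_zero (Set.toFinite _)] at h1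
  exact Set.eq_empty_iff_forall_notMem.1 h1 x rfl

lemma exists_wlColoring_eq' (h : ¬ WLDistinguishes k G H) (y : Fin k → W) :
    ∃ x : Fin k → V,
      wlColoring G k (wlStableRound G H k) x = wlColoring H k (wlStableRound G H k) y := by
  rw [WLDistinguishes] at h
  push Not at h
  have h1 := h (wlColoring H k (wlStableRound G H k) y)
  by_contra! hcon
  have h2 : {x | wlColoring G k (wlStableRound G H k) x
      = wlColoring H k (wlStableRound G H k) y} = ∅ := by
    ext x; simpa using hcon x
  rw [h2, Set.ncard_empty, eq_comm, Set.ncard_eq_zero (Set.toFinite _)] at h1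
  exact Set.eq_empty_iff_forall_notMem.1 h1 y rfl

lemma eq_bot_of_not_wlDistinguishes (hk : 1 ≤ k) (h : ¬ WLDistinguishes k G H) (hG : G = ⊥) :
    H = ⊥ := by
  subst hG
  ext u v
  simp only [SimpleGraph.bot_adj, iff_false]
  intro huv
  rcases hk.eq_or_lt with rfl | hk
  · obtain ⟨x, hx⟩ := exists_wlColoring_eq' h fun _ => u
    have := degree_eq_of_wlColoring_succ_eq (wlColoring_succ_eq_of_stable hx)
    simp only [SimpleGraph.bot_adj, filter_false, card_empty] at this
    exact card_ne_zero_of_mem (mem_filter.2 ⟨mem_univ v, huv⟩) this.symm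
  · obtain ⟨x, hx⟩ := exists_wlColoring_eq' h fun a => if a = ⟨0, by omega⟩ then u else v
    have := atomic_of_wlColoring_eq hx ⟨0, by omega⟩ ⟨1, hk⟩
    simp at this
    exact this huv

/-- If `k`-WL does not distinguish `G` and `H`, then every choice of fewer than `k` vertices of
`G` is matched by vertices of `H`, up to edit cost the spread of the trace partition. -/
lemma exists_editCost_le_spread (hk : 2 ≤ k) (h : ¬ WLDistinguishes k G H) [Nonempty V]
    {S : Finset V} (hS : #S < k) :
    ∃ π : V ≃ W, 2 * (editCost G H π : ℝ) ≤ spread G (nbhdTrace G S) := by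
  set r := wlStableRound G H k
  -- Slot `a0` stays free and the others hold `S`; `a1` is overwritten only to read off adjacency.
  let a0 : Fin k := ⟨0, by omega⟩
  let a1 : Fin k := ⟨1, by omega⟩
  have h10 : a1 ≠ a0 := by simp [a0, a1]
  have h01 := h10.symm
  obtain ⟨x, hx⟩ : ∃ x : Fin k → V, ∀ s ∈ S, ∃ a, a ≠ a0 ∧ x a = s := by
    have hle : Fintype.card S ≤ Fintype.card {a : Fin k // a ≠ a0} := by
      rw [Fintype.card_coe, Fintype.card_subtype_compl, Fintype.card_fin]
      simp
      omega
    obtain ⟨e⟩ := Function.Embedding.nonempty_of_card_le hle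
    refine ⟨fun a => if ha : ∃ s : S, (e s : Fin k) = a then ha.choose else Classical.arbitrary V,
      fun s hs => ⟨e ⟨s, hs⟩, (e ⟨s, hs⟩).2, ?_⟩⟩
    have ha : ∃ s' : S, (e s' : Fin k) = e ⟨s, hs⟩ := ⟨_, rfl⟩
    simp only [dif_pos ha]
    exact congrArg Subtype.val (e.injective (Subtype.ext ha.choose_spec))
  obtain ⟨y, hxy⟩ := exists_wlColoring_eq h x
  let f : V → WLColor k r := fun v => wlColoring G k r (Function.update x a0 v)
  let g : W → WLColor k r := fun w => wlColoring H k r (Function.update y a0 w)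
  have hcard : ∀ c, #{v | f v = c} = #{w | g w = c} := fun c =>
    card_filter_eq_of_wlColoring_succ_eq (by omega) (wlColoring_succ_eq_of_stable hxy)
      fun q => q a0 = c
  have hdeg : ∀ v w c, f v = g w →
      #{u | f u = c ∧ G.Adj v u} = #{u | g u = c ∧ H.Adj w u} := by
    intro v w c hvw
    -- Placing `u` in slot `a0` yields its colour; placing it in `a1`, with `v` in `a0`, yields
    -- adjacency. The existentials over `z` make adjacency a predicate of the colour alone.
    have h1 := card_filter_eq_of_wlColoring_succ_eq (by omega)
      (wlColoring_succ_eq_of_stable hvw)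
      fun q => q a0 = c ∧ ((∃ z : Fin k → V, G.Adj (z a0) (z a1) ∧ q a1 = wlColoring G k r z) ∨
        ∃ z : Fin k → W, H.Adj (z a0) (z a1) ∧ q a1 = wlColoring H k r z)
    simp only [Function.update_idem] at h1
    convert h1 using 4 with u _ u _
    · constructor
      · intro hvu
        exact Or.inl ⟨_, by simpa [h01] using hvu, rfl⟩
      · rintro (⟨z, hz, hzq⟩ | ⟨z, hz, hzq⟩) <;>
          simpa [h01] using (atomic_of_wlColoring_eq hzq a0 a1).2 hz
    · constructor
      · intro hvu
        exact Or.inr ⟨_, by simpa [h01] using hvu, rfl⟩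
      · rintro (⟨z, hz, hzq⟩ | ⟨z, hz, hzq⟩) <;>
          simpa [h01] using (atomic_of_wlColoring_eq hzq a0 a1).2 hz
  obtain ⟨π, hπ⟩ := exists_equiv_editCost_le hcard hdeg
  refine ⟨π, hπ.trans (spread_le_of_refines ?_)⟩
  intro v u hvu
  rw [nbhdTrace_eq_iff]
  intro s hs
  obtain ⟨a, ha, rfl⟩ := hx s hs
  have := atomic_of_wlColoring_eq hvu a0 a
  simpa [ha] using this

omit [Fintype V] [Fintype W] in
lemma editDist_le_editCost (π : V ≃ W) : editDist G H ≤ editCost G H π :=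
  ciInf_le (OrderBot.bddBelow _) π

end WeisfeilerLeman

end RobustGI

/-! ### Choice of constants and conclusion -/

theorem mainTheorem5 :
    ∃ C : ℝ, 0 < C ∧
      ∀ (d : ℕ) (ε : ℝ), 0 < ε →
      ∀ k : ℕ, 1 ≤ k → C * ((d : ℝ) / ε * Real.log (1 / ε)) ≤ (k : ℝ) →
      ∀ (n : ℕ) (V W : Type*) [Fintype V] [Fintype W] (G : SimpleGraph V) (H : SimpleGraph W),
        Fintype.card V = n → Fintype.card W = n →
        IsEmpty (G ≃g H) →
        RobustGI.graphVCDim G ≤ d →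
        ε * (n : ℝ) ^ 2 ≤ (RobustGI.editDist G H : ℝ) →
        RobustGI.WLDistinguishes k G H := by
  -- With `q = (d/ε) log (1/ε) > 1`, the required size of `S` is below `k - 1`, as `2 (d/ε) log
  -- (2/ε) ≤ 4q < 8q - 1`.
  refine ⟨8, by norm_num, ?_⟩
  intro d ε hε k hk hkd n V W _ _ G H hV hW hiso hd hedit
  by_contra hcon
  have e : V ≃ W := Fintype.equivOfCardEq (hV.trans hW.symm)
  rcases Nat.eq_zero_or_pos n with hn | hn
  · subst hn
    have := Fintype.card_eq_zero_iff.1 hV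
    exact hiso.false ⟨e, fun {a} => isEmptyElim a⟩
  have hn' : (0 : ℝ) < (n : ℝ) ^ 2 := by positivity
  have : Nonempty V := Fintype.card_pos_iff.1 (by omega)
  have hle : ∀ π : V ≃ W, ε * (n : ℝ) ^ 2 ≤ RobustGI.editCost G H π := fun π =>
    hedit.trans (by exact_mod_cast RobustGI.editDist_le_editCost π)
  have hhalf : ε ≤ 1 / 2 := by
    have h1 := RobustGI.two_mul_editCost_le G H e
    rw [hV] at h1
    have h2 : ε * (n : ℝ) ^ 2 ≤ 1 / 2 * (n : ℝ) ^ 2 := by linarith [hle e]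
    exact le_of_mul_le_mul_right h2 hn'
  -- For `d = 0` the bound on `k` is void and `k = 1` must be handled, but `G` is then edgeless.
  rcases Nat.eq_zero_or_pos d with hd0 | hd0
  · have hG := RobustGI.eq_bot_of_graphVCDim_eq_zero (by omega : RobustGI.graphVCDim G = 0)
    have hH := RobustGI.eq_bot_of_not_wlDistinguishes hk hcon hG
    subst hG hH
    exact hiso.false ⟨e, by simp⟩
  have hlog2 : 1 / 2 < Real.log 2 := by linarith [Real.log_two_gt_d9]
  have hlog : Real.log 2 ≤ Real.log (1 / ε) := by
    refine Real.log_le_log (by norm_num) ?_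
    rw [le_div_iff₀ hε]
    linarith
  have hlog' : Real.log (2 / ε) ≤ 2 * Real.log (1 / ε) := by
    rw [div_eq_mul_one_div, Real.log_mul (by norm_num) (by positivity)]
    linarith
  have hdε : 2 ≤ (d : ℝ) / ε := by
    rw [le_div_iff₀ hε]
    have : (1 : ℝ) ≤ d := by exact_mod_cast hd0
    linarith
  have hq : 1 < (d : ℝ) / ε * Real.log (1 / ε) := by nlinarith
  have hk2 : 2 ≤ k := by
    have : (2 : ℝ) ≤ k := by linarith
    exact_mod_cast this
  have hs : 2 * ((d : ℝ) / ε * Real.log (2 / ε)) < ((k - 1 : ℕ) : ℝ) := by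
    have h1 : (d : ℝ) / ε * Real.log (2 / ε) ≤ d / ε * (2 * Real.log (1 / ε)) := by gcongr
    push_cast [hk]
    linarith
  obtain ⟨S, hS, hspread⟩ := RobustGI.exists_nbhdTrace_spread_le G hd hε (by linarith) hs
  obtain ⟨π, hπ⟩ := RobustGI.exists_editCost_le_spread hk2 hcon (S := S) (by omega)
  rw [hV] at hspread
  have := mul_pos hε hn'
  linarith [hle π]
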